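/- An algebra is a nonempty set with a family of finitary operations, and a variety is the class of all algebras in a fixed algebraic language that satisfy a given set of identities. A congruence $\theta$ of an algebra $A$ is a factor congruence if there is a congruence $\theta^*$ of $A$ with $\theta\cap\theta^*=\{(a,a):a\in A\}$ and $\theta\circ\theta^*=A\times A$ (relational product). A variety $\mathcal V$ has Boolean factor congruences (BFC) if, for every $A\in\mathcal V$, the set of factor congruences of $A$ is a distributive sublattice of the congruence lattice of $A$. Theorem. Let $\mathcal V$ be a variety. The following are equivalent. (1) There is a first-order formula $\pi(x,y,z,w)$ in the language of $\mathcal V$ that is preserved by direct factors and direct products in $\mathcal V$ (for $A,B\in\mathcal V$, if a tuple satisfies $\pi$ in $A\times B$, then its two projections satisfy $\pi$ in $A$ and in $B$; for every family $(A_i)_{i\in I}$ in $\mathcal V$, a tuple of $\prod_i A_i$ all of whose projections satisfy $\pi$ in the $A_i$ satisfies $\pi$ in $\prod_i A_i$), and such that (a) $\mathcal V\models\pi(x,y,x,y)$; (b) $\mathcal V\models\pi(x,x,z,w)$; (c) $\mathcal V\models\pi(x,y,z,z)\rightarrow x=y$. (2) $\mathcal V$ has BFC. -/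

import Mathlib

universe u v w

namespace UniversalAlgebra

/-- A formal identity `s ≈ t` in the variables `x₀, x₁, x₂, …` over the language `L`. -/
abbrev Identity (L : FirstOrder.Language.{u, v}) : Type u := L.Term ℕ × L.Term ℕ

/-- `A` satisfies every identity in `E`. The variety axiomatized by `E` consists of all nonempty
`L`-structures with this property. -/
def IsModel {L : FirstOrder.Language.{u, v}} (E : Set (Identity L)) (A : Type w)
    [L.Structure A] : Prop :=
  ∀ e ∈ E, ∀ a : ℕ → A, e.1.realize a = e.2.realize a

/-- The direct product of a family of structures, with componentwise operations. -/
instance piStructure {L : FirstOrder.Language.{u, v}} {ι : Type w} (A : ι → Type w)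
    [∀ i, L.Structure (A i)] : L.Structure (∀ i, A i) where
  funMap f x := fun i => FirstOrder.Language.Structure.funMap f (fun j => x j i)
  RelMap r x := ∀ i, FirstOrder.Language.Structure.RelMap r (fun j => x j i)

/-- The direct product of two structures, with componentwise operations. -/
instance prodStructure {L : FirstOrder.Language.{u, v}} (A B : Type w)
    [L.Structure A] [L.Structure B] : L.Structure (A × B) where
  funMap f x := (FirstOrder.Language.Structure.funMap f (fun j => (x j).1),
    FirstOrder.Language.Structure.funMap f (fun j => (x j).2))
  RelMap r x := FirstOrder.Language.Structure.RelMap r (fun j => (x j).1) ∧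
    FirstOrder.Language.Structure.RelMap r (fun j => (x j).2)

/-- In the variety axiomatized by `E`, the formula `π` is preserved by direct products (of
arbitrary families). -/
def PreservedByProducts {L : FirstOrder.Language.{u, v}} (E : Set (Identity L)) {α : Type}
    (π : L.Formula α) : Prop :=
  ∀ (ι : Type w) (A : ι → Type w) [∀ i, L.Structure (A i)] [∀ i, Nonempty (A i)],
    (∀ i, IsModel E (A i)) →
    ∀ a : α → ∀ i, A i, (∀ i, π.Realize (fun k => a k i)) → π.Realize a

/-- In the variety axiomatized by `E`, the formula `π` is preserved by direct factors. -/
def PreservedByFactors {L : FirstOrder.Language.{u, v}} (E : Set (Identity L)) {α : Type}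
    (π : L.Formula α) : Prop :=
  ∀ (A B : Type w) [L.Structure A] [L.Structure B] [Nonempty A] [Nonempty B],
    IsModel E A → IsModel E B →
    ∀ a : α → A × B, π.Realize a →
      π.Realize (fun k => (a k).1) ∧ π.Realize (fun k => (a k).2)

/-- A congruence of `A`: an equivalence relation compatible with all basic operations. -/
structure Congruence (L : FirstOrder.Language.{u, v}) (A : Type w) [L.Structure A]
    extends Setoid A where
  compatible : ∀ {n : ℕ} (f : L.Functions n) (x y : Fin n → A),
    (∀ i, toSetoid (x i) (y i)) →
      toSetoid (FirstOrder.Language.Structure.funMap f x) (FirstOrder.Language.Structure.funMap f y)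

namespace Congruence

variable {L : FirstOrder.Language.{u, v}} {A : Type w} [L.Structure A]

theorem toSetoid_injective {θ ψ : Congruence L A} (h : θ.toSetoid = ψ.toSetoid) : θ = ψ := by
  cases θ
  cases ψ
  cases h
  rfl

/-- Congruences are ordered by inclusion. -/
instance : PartialOrder (Congruence L A) where
  le θ ψ := ∀ ⦃x y : A⦄, θ.toSetoid x y → ψ.toSetoid x y
  le_refl _ _ _ h := h
  le_trans _ _ _ h₁ h₂ _ _ h := h₂ (h₁ h)
  le_antisymm _ _ h₁ h₂ :=
    toSetoid_injective (Setoid.ext fun _ _ => ⟨fun h => h₁ h, fun h => h₂ h⟩)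

instance : InfSet (Congruence L A) where
  sInf S :=
    { r := fun x y => ∀ θ ∈ S, θ.toSetoid x y
      iseqv := ⟨fun x θ _ => θ.toSetoid.refl x, fun h θ hθ => θ.toSetoid.symm (h θ hθ),
        fun h₁ h₂ θ hθ => θ.toSetoid.trans (h₁ θ hθ) (h₂ θ hθ)⟩
      compatible := fun f x y h θ hθ => θ.compatible f x y (fun i => h i θ hθ) }

/-- The congruence lattice of `A`. -/
instance : CompleteLattice (Congruence L A) where
  __ := completeLatticeOfInf (Congruence L A) fun _ =>
    ⟨fun θ hθ _ _ h => h θ hθ, fun _ hθ _ _ h _ hψ => hθ hψ h⟩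
  inf θ ψ :=
    { toSetoid := θ.toSetoid ⊓ ψ.toSetoid
      compatible := fun f x y h =>
        ⟨θ.compatible f x y (fun i => (h i).1), ψ.compatible f x y (fun i => (h i).2)⟩ }
  inf_le_left _ _ := fun _ _ h => h.1
  inf_le_right _ _ := fun _ _ h => h.2
  le_inf _ _ _ h₁ h₂ := fun _ _ h => ⟨h₁ h, h₂ h⟩
  top :=
    { toSetoid := ⊤
      compatible := fun _ _ _ _ => trivial }
  le_top _ := fun _ _ _ => trivial
  bot :=
    { toSetoid := ⊥
      compatible := fun f _ _ h => congrArg (FirstOrder.Language.Structure.funMap f) (funext h) }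
  bot_le θ := fun x _ h => h ▸ θ.toSetoid.refl x

/-- `θ` and `ψ` are complementary factor congruences: their intersection is the trivial congruence
and their relational composition is the universal one. -/
def IsComplementaryFactor (θ ψ : Congruence L A) : Prop :=
  θ ⊓ ψ = ⊥ ∧ ∀ x y : A, ∃ z : A, θ.toSetoid x z ∧ ψ.toSetoid z y

variable (L A) in
/-- The set of factor congruences of `A`. -/
def factorCongruences : Set (Congruence L A) :=
  {θ | ∃ ψ : Congruence L A, IsComplementaryFactor θ ψ}

end Congruence

/-- The variety axiomatized by `E` has Boolean factor congruences: in each of its algebras, the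
factor congruences form a distributive sublattice of the congruence lattice. -/
def HasBFC {L : FirstOrder.Language.{u, v}} (E : Set (Identity L)) : Prop :=
  ∀ (A : Type w) [L.Structure A] [Nonempty A], IsModel E A →
    ∃ S : Sublattice (Congruence L A),
      (S : Set (Congruence L A)) = Congruence.factorCongruences L A ∧
      ∀ θ ∈ S, ∀ φ ∈ S, ∀ ψ ∈ S, θ ⊓ (φ ⊔ ψ) = (θ ⊓ φ) ⊔ (θ ⊓ ψ)

/-- In the variety axiomatized by `E`, the formula `π(x, y, z, w)` satisfies `π(x, y, x, y)`,
`π(x, x, z, w)`, and `π(x, y, z, z) → x = y`. -/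
def SatisfiesStar {L : FirstOrder.Language.{u, v}} (E : Set (Identity L))
    (π : L.Formula (Fin 4)) : Prop :=
  ∀ (A : Type w) [L.Structure A] [Nonempty A], IsModel E A →
    (∀ x y : A, π.Realize ![x, y, x, y]) ∧
    (∀ x z w : A, π.Realize ![x, x, z, w]) ∧
    (∀ x y z : A, π.Realize ![x, y, z, z] → x = y)

end UniversalAlgebra

/-!
Why the theorem holds.

*From the formula to Boolean factor congruences.* Let `θ` be a factor congruence and `φ`, `φ'` a
complementary pair. If `x = a` and `y = b` modulo `φ`, and `x = y` modulo `φ'`, then `π(x, y, a, b)`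
holds modulo `φ` and modulo `φ'`, hence in the algebra, hence modulo `θ`; so `θ` identifies `x` and
`y` as soon as it identifies `a` and `b`. Thus every factor congruence is compatible with the
decomposition maps of every other one (`DecompositionsRespectFactors`), and this gives explicit
descriptions of joins, complements, and distributivity.

*From Boolean factor congruences to the formula.* This is an interpolation argument. Call a formula
factorable if it holds in a reduced product, modulo any filter, exactly when it holds at almost all
coordinates. Factorable formulas are preserved by products and factors; they contain the equations
and are closed under conjunction and under passing from `φ, ψ` to `∃ u, φ ∧ ∀ u, (φ → ψ)`. Suppose
that no factorable formula has the three properties. Products of counterexamples then provide two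
algebras of the variety:
* `A` with complementary factor congruences `φ`, `φ'` and elements satisfying
  `x φ y`, `x φ' z`, `y φ' w`;
* `B` with a factor congruence `θ` and elements with `z θ w` but not `x θ y`,

such that `(x, y, z, w)` satisfies the same factorable formulas in both
(`exists_factorablyEquiv_of_forall_not`). The closure properties allow `B` to be mapped into a reduced
power of `A`, preserving and reflecting factorable formulas and matching the two tuples
(`FactorablyEquiv.extend`). Iterating, with the roles of the two algebras exchanged each time, gives
a chain in which every algebra, from the third on, is a reduced power of the last but one, so both
decompositions pass to its union (`exists_common_extension`). There `(x, y)` lies in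
`φ ∧ (φ' ∨ θ) = (φ ∧ φ') ∨ (φ ∧ θ) = φ ∧ θ`, contradicting that `x θ y` fails.
-/

namespace UniversalAlgebra

open FirstOrder FirstOrder.Language Filter

/-! ### Homomorphisms, quotients and products of algebras -/

section Homs

variable {L : FirstOrder.Language.{u, v}} {E : Set (Identity L)}

theorem IsModel.of_surjective {A B : Type w} [L.Structure A] [L.Structure B] (hA : IsModel E A)
    (g : A →[L] B) (hg : Function.Surjective g) : IsModel E B := by
  intro e he b
  obtain ⟨a, rfl⟩ : ∃ a : ℕ → A, g ∘ a = b := hg.comp_left b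
  rw [HomClass.realize_term, HomClass.realize_term, hA e he a]

variable [L.IsAlgebraic]

/-- A map commuting with the basic operations is a homomorphism, as there are no relations. -/
def homOfMapFun {A B : Type w} [L.Structure A] [L.Structure B] (g : A → B)
    (h : ∀ {n : ℕ} (f : L.Functions n) (x : Fin n → A),
      g (Structure.funMap f x) = Structure.funMap f (g ∘ x)) : A →[L] B where
  toFun := g
  map_fun' := h
  map_rel' r := isEmptyElim r

/-- A bijective homomorphism is an isomorphism, as there are no relations. -/
noncomputable def equivOfBijective {A B : Type w} [L.Structure A] [L.Structure B]
    (g : A →[L] B) (hg : Function.Bijective g) : A ≃[L] B where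
  toEquiv := Equiv.ofBijective g hg
  map_fun' := g.map_fun
  map_rel' r := isEmptyElim r

/-- Evaluation of a direct product at a coordinate. -/
def evalHom {ι : Type w} (A : ι → Type w) [∀ i, L.Structure (A i)] (i : ι) :
    (∀ i, A i) →[L] A i :=
  homOfMapFun (fun a => a i) fun _ _ => rfl

theorem realize_term_pi {ι : Type w} (A : ι → Type w) [∀ i, L.Structure (A i)] {α : Type*}
    (t : L.Term α) (a : α → ∀ i, A i) (i : ι) :
    t.realize a i = t.realize fun k => a k i :=
  (HomClass.realize_term (evalHom A i)).symm

theorem IsModel.pi {ι : Type w} {A : ι → Type w} [∀ i, L.Structure (A i)]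
    (hA : ∀ i, IsModel E (A i)) : IsModel E (∀ i, A i) := by
  intro e he a
  funext i
  rw [realize_term_pi, realize_term_pi, hA i e he]

end Homs

namespace Congruence

variable {L : FirstOrder.Language.{u, v}} {A : Type w} [L.Structure A]

theorem ext_rel {θ ψ : Congruence L A} (h : ∀ x y, θ.toSetoid x y ↔ ψ.toSetoid x y) : θ = ψ :=
  toSetoid_injective (Setoid.ext h)

/-- The quotient algebra of `A` by the congruence `θ`. -/
def Quot (θ : Congruence L A) : Type w := Quotient θ.toSetoid

/-- The class of an element in the quotient algebra. -/
def toQuot (θ : Congruence L A) (x : A) : θ.Quot := Quotient.mk θ.toSetoid x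

theorem toQuot_surjective (θ : Congruence L A) : Function.Surjective θ.toQuot :=
  Quotient.exists_rep

theorem toQuot_eq_iff {θ : Congruence L A} {x y : A} :
    θ.toQuot x = θ.toQuot y ↔ θ.toSetoid x y :=
  Quotient.eq

instance [Nonempty A] (θ : Congruence L A) : Nonempty θ.Quot := .map θ.toQuot inferInstance

/-- Operations of the quotient algebra are computed on chosen representatives. A relation holds in
the quotient if it holds on some representatives; this matters only for languages that are not
algebraic. -/
noncomputable instance (θ : Congruence L A) : L.Structure θ.Quot where
  funMap f x := θ.toQuot (Structure.funMap f fun i => (x i).out)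
  RelMap r x := ∃ a, θ.toQuot ∘ a = x ∧ Structure.RelMap r a

/-- The canonical projection onto the quotient algebra. -/
noncomputable def quotHom (θ : Congruence L A) : A →[L] θ.Quot where
  toFun := θ.toQuot
  map_fun' f x := (toQuot_eq_iff.2 <| θ.compatible f _ _ fun i =>
    toQuot_eq_iff.1 (Quotient.out_eq (θ.toQuot (x i)))).symm
  map_rel' _ x h := ⟨x, rfl, h⟩

theorem realize_term_quot (θ : Congruence L A) {α : Type*} (t : L.Term α) (a : α → A) :
    t.realize (fun k => θ.toQuot (a k)) = θ.toQuot (t.realize a) :=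
  HomClass.realize_term θ.quotHom

theorem isModel_quot {E : Set (Identity L)} (θ : Congruence L A) (hA : IsModel E A) :
    IsModel E θ.Quot :=
  hA.of_surjective θ.quotHom θ.toQuot_surjective

/-- A congruence `ψ` above `θ` induces a congruence on the quotient by `θ`. -/
noncomputable def push (θ ψ : Congruence L A) (h : θ ≤ ψ) : Congruence L θ.Quot where
  r x y := ψ.toSetoid x.out y.out
  iseqv := ⟨fun _ => ψ.toSetoid.refl _, fun h => ψ.toSetoid.symm h,
    fun h h' => ψ.toSetoid.trans h h'⟩
  compatible f x y hxy := by
    have key : ∀ a : A, ψ.toSetoid (θ.toQuot a).out a := fun a =>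
      h (toQuot_eq_iff.1 (Quotient.out_eq (θ.toQuot a)))
    exact ψ.toSetoid.trans (key _)
      (ψ.toSetoid.trans (ψ.compatible f _ _ hxy) (ψ.toSetoid.symm (key _)))

theorem push_toQuot {θ ψ : Congruence L A} (h : θ ≤ ψ) (x y : A) :
    (push θ ψ h).toSetoid (θ.toQuot x) (θ.toQuot y) ↔ ψ.toSetoid x y := by
  have key : ∀ a : A, ψ.toSetoid (θ.toQuot a).out a := fun a =>
    h (toQuot_eq_iff.1 (Quotient.out_eq (θ.toQuot a)))
  exact ⟨fun h' => ψ.toSetoid.trans (ψ.toSetoid.symm (key x)) (ψ.toSetoid.trans h' (key y)),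
    fun h' => ψ.toSetoid.trans (key x) (ψ.toSetoid.trans h' (ψ.toSetoid.symm (key y)))⟩

namespace IsComplementaryFactor

variable {θ ψ : Congruence L A}

theorem eq_of_rel (h : IsComplementaryFactor θ ψ) {x y : A} (h₁ : θ.toSetoid x y)
    (h₂ : ψ.toSetoid x y) : x = y := by
  have : (θ ⊓ ψ).toSetoid x y := ⟨h₁, h₂⟩
  rw [h.1] at this
  exact this

theorem of_rel (h₁ : ∀ x y, θ.toSetoid x y → ψ.toSetoid x y → x = y)
    (h₂ : ∀ x y, ∃ z, θ.toSetoid x z ∧ ψ.toSetoid z y) : IsComplementaryFactor θ ψ :=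
  ⟨ext_rel fun x y => ⟨fun h => h₁ x y h.1 h.2,
    fun h => (show x = y from h) ▸ (θ ⊓ ψ).toSetoid.refl x⟩, h₂⟩

theorem symm (h : IsComplementaryFactor θ ψ) : IsComplementaryFactor ψ θ :=
  of_rel (fun _ _ h₁ h₂ => h.eq_of_rel h₂ h₁) fun x y =>
    let ⟨z, h₁, h₂⟩ := h.2 y x
    ⟨z, ψ.toSetoid.symm h₂, θ.toSetoid.symm h₁⟩

end IsComplementaryFactor

theorem isComplementaryFactor_top_bot : IsComplementaryFactor (⊤ : Congruence L A) ⊥ :=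
  .of_rel (fun _ _ _ h => h) fun _ y => ⟨y, trivial, rfl⟩

theorem sup_rel_of {θ ψ : Congruence L A} {x y z : A} (h₁ : θ.toSetoid x y)
    (h₂ : ψ.toSetoid y z) : (θ ⊔ ψ).toSetoid x z :=
  (θ ⊔ ψ).toSetoid.trans ((le_sup_left : θ ≤ θ ⊔ ψ) h₁) ((le_sup_right : ψ ≤ θ ⊔ ψ) h₂)

end Congruence

section Transfer

variable {L : FirstOrder.Language.{u, v}} [L.IsAlgebraic] {E : Set (Identity L)}

/-- The two-element family with members `A` and `B`. -/
def pairFamily (A B : Type w) : ULift.{w} Bool → Type w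
  | ⟨true⟩ => A
  | ⟨false⟩ => B

instance (A B : Type w) [L.Structure A] [L.Structure B] :
    ∀ i, L.Structure (pairFamily A B i)
  | ⟨true⟩ => inferInstanceAs (L.Structure A)
  | ⟨false⟩ => inferInstanceAs (L.Structure B)

instance (A B : Type w) [Nonempty A] [Nonempty B] : ∀ i, Nonempty (pairFamily A B i)
  | ⟨true⟩ => inferInstanceAs (Nonempty A)
  | ⟨false⟩ => inferInstanceAs (Nonempty B)

/-- The element of the product of `pairFamily A B` with the given coordinates. -/
def pairElem {A B : Type w} (x : A × B) : ∀ i, pairFamily A B i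
  | ⟨true⟩ => x.1
  | ⟨false⟩ => x.2

theorem realize_prod_iff_pairElem {A B : Type w} [L.Structure A] [L.Structure B] {α : Type*}
    (φ : L.Formula α) (a : α → A × B) :
    φ.Realize a ↔ φ.Realize fun k => pairElem (a k) := by
  let g : A × B →[L] ∀ i, pairFamily A B i := homOfMapFun pairElem fun f x => by
    funext i
    obtain ⟨_ | _⟩ := i <;> rfl
  have hg : Function.Bijective g :=
    ⟨fun x y h => Prod.ext (congrFun h ⟨true⟩) (congrFun h ⟨false⟩), fun x =>
      ⟨(x ⟨true⟩, x ⟨false⟩), by funext i; obtain ⟨_ | _⟩ := i <;> rfl⟩⟩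
  exact (StrongHomClass.realize_formula (equivOfBijective g hg) φ).symm

theorem Congruence.IsComplementaryFactor.realize_iff_prod {A : Type w} [L.Structure A]
    {θ ψ : Congruence L A} (h : θ.IsComplementaryFactor ψ) {α : Type*} (φ : L.Formula α)
    (a : α → A) : φ.Realize a ↔ φ.Realize fun k => (θ.toQuot (a k), ψ.toQuot (a k)) := by
  let g : A →[L] θ.Quot × ψ.Quot := homOfMapFun (fun x => (θ.toQuot x, ψ.toQuot x)) fun f x =>
    Prod.ext (θ.quotHom.map_fun f x) (ψ.quotHom.map_fun f x)
  have hg : Function.Bijective g := by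
    refine ⟨fun x y hxy => h.eq_of_rel (Congruence.toQuot_eq_iff.1 (congrArg Prod.fst hxy))
      (Congruence.toQuot_eq_iff.1 (congrArg Prod.snd hxy)), fun ⟨x, y⟩ => ?_⟩
    obtain ⟨x, rfl⟩ := θ.toQuot_surjective x
    obtain ⟨y, rfl⟩ := ψ.toQuot_surjective y
    obtain ⟨z, h₁, h₂⟩ := h.2 x y
    exact ⟨z, Prod.ext (Congruence.toQuot_eq_iff.2 (θ.toSetoid.symm h₁))
      (Congruence.toQuot_eq_iff.2 h₂)⟩
  exact (StrongHomClass.realize_formula (equivOfBijective g hg) φ).symm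

/-- A formula preserved by factors and products holds in `A` exactly when it holds in both
quotients by a pair of complementary factor congruences. -/
theorem realize_iff_quot {π : L.Formula (Fin 4)} (hF : PreservedByFactors.{u, v, w} E π)
    (hP : PreservedByProducts.{u, v, w} E π) {A : Type w} [L.Structure A] [Nonempty A]
    (hA : IsModel E A) {θ ψ : Congruence L A} (h : θ.IsComplementaryFactor ψ) (a : Fin 4 → A) :
    π.Realize a ↔ (π.Realize fun k => θ.toQuot (a k)) ∧ π.Realize fun k => ψ.toQuot (a k) := by
  rw [h.realize_iff_prod]
  refine ⟨fun h' => hF _ _ (θ.isModel_quot hA) (ψ.isModel_quot hA) _ h', fun h' => ?_⟩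
  rw [realize_prod_iff_pairElem]
  refine hP _ (pairFamily θ.Quot ψ.Quot) ?_ _ ?_
  · rintro ⟨_ | _⟩
    exacts [ψ.isModel_quot hA, θ.isModel_quot hA]
  · rintro ⟨_ | _⟩
    exacts [h'.2, h'.1]

end Transfer

/-! ### The formula yields Boolean factor congruences -/

section BFC

variable {L : FirstOrder.Language.{u, v}} {A : Type w} [L.Structure A]

namespace Congruence

/-- The decomposition maps of factor congruences respect all factor congruences: if `x` has the
coordinates of `a` modulo `φ` and of `c` modulo `φ'`, and `y` those of `b` and `c`, then every
factor congruence identifying `a` and `b` identifies `x` and `y`. -/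
def DecompositionsRespectFactors (L : FirstOrder.Language.{u, v}) (A : Type w)
    [L.Structure A] : Prop :=
  ∀ ⦃θ φ φ' : Congruence L A⦄, θ ∈ factorCongruences L A → φ.IsComplementaryFactor φ' →
    ∀ ⦃a b x y : A⦄, θ.toSetoid a b → φ.toSetoid x a → φ.toSetoid y b → φ'.toSetoid x y →
      θ.toSetoid x y

variable {θ θ' φ φ' ψ ψ' : Congruence L A}

theorem DecompositionsRespectFactors.sup_iff (H : DecompositionsRespectFactors L A)
    (hθ : θ ∈ factorCongruences L A) (hφ : φ.IsComplementaryFactor φ') {x y : A} :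
    (θ ⊔ φ).toSetoid x y ↔ ∃ z, φ.toSetoid x z ∧ φ'.toSetoid z y ∧ θ.toSetoid z y := by
  refine ⟨?_, fun ⟨z, h₁, _, h₂⟩ => (θ ⊔ φ).toSetoid.symm
    (sup_rel_of (θ.toSetoid.symm h₂) (φ.toSetoid.symm h₁))⟩
  let J : Congruence L A :=
    { r := fun x y => ∃ z, φ.toSetoid x z ∧ φ'.toSetoid z y ∧ θ.toSetoid z y
      iseqv := by
        refine ⟨fun x => ⟨x, φ.toSetoid.refl x, φ'.toSetoid.refl x, θ.toSetoid.refl x⟩, ?_, ?_⟩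
        · rintro x y ⟨z, h₁, _, h₂⟩
          obtain ⟨w, hw, hw'⟩ := hφ.2 y x
          exact ⟨w, hw, hw', H hθ hφ (θ.toSetoid.symm h₂) (φ.toSetoid.symm hw) h₁ hw'⟩
        · rintro x y t ⟨z, h₁, _, h₂⟩ ⟨z', h₁', h₃', h₂'⟩
          obtain ⟨w, hw, hw'⟩ := hφ.2 x t
          refine ⟨w, hw, hw', θ.toSetoid.trans (H hθ hφ h₂ ?_ (φ.toSetoid.symm h₁') ?_) h₂'⟩
          · exact φ.toSetoid.trans (φ.toSetoid.symm hw) h₁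
          · exact φ'.toSetoid.trans hw' (φ'.toSetoid.symm h₃')
      compatible := by
        intro n f x y h
        choose z h₁ h₂ h₃ using h
        exact ⟨_, φ.compatible f _ _ h₁, φ'.compatible f _ _ h₂, θ.compatible f _ _ h₃⟩ }
  refine fun h => (sup_le (c := J) ?_ ?_ : θ ⊔ φ ≤ J) h
  · intro x y h
    obtain ⟨z, hz, hz'⟩ := hφ.2 x y
    exact ⟨z, hz, hz', H hθ hφ h (φ.toSetoid.symm hz) (φ.toSetoid.refl y) hz'⟩
  · exact fun x y h => ⟨y, h, φ'.toSetoid.refl y, θ.toSetoid.refl y⟩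

theorem DecompositionsRespectFactors.isComplementaryFactor_sup
    (H : DecompositionsRespectFactors L A) (hθ : θ.IsComplementaryFactor θ')
    (hφ : φ.IsComplementaryFactor φ') : (θ ⊔ φ).IsComplementaryFactor (θ' ⊓ φ') := by
  refine .of_rel (fun x y h h' => ?_) fun x y => ?_
  · obtain ⟨z, h₁, h₂, h₃⟩ := (H.sup_iff ⟨θ', hθ⟩ hφ).1 h
    obtain rfl := hφ.eq_of_rel h₁ (φ'.toSetoid.trans h'.2 (φ'.toSetoid.symm h₂))
    exact hθ.eq_of_rel h₃ h'.1
  · obtain ⟨z, hz, hz'⟩ := hφ.2 x y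
    obtain ⟨w, hw, hw'⟩ := hθ.2 z y
    refine ⟨w, ?_, hw', H ⟨φ, hφ.symm⟩ hθ hz' (θ.toSetoid.symm hw) (θ.toSetoid.refl y) hw'⟩
    exact (θ ⊔ φ).toSetoid.symm (sup_rel_of (θ.toSetoid.symm hw) (φ.toSetoid.symm hz))

theorem DecompositionsRespectFactors.inf_sup_le (H : DecompositionsRespectFactors L A)
    (hθ : θ ∈ factorCongruences L A) (hφ : φ ∈ factorCongruences L A)
    (hψ : ψ.IsComplementaryFactor ψ') : θ ⊓ (φ ⊔ ψ) ≤ (θ ⊓ φ) ⊔ (θ ⊓ ψ) := by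
  intro x y h
  obtain ⟨z, h₁, h₂, h₃⟩ := (H.sup_iff hφ hψ).1 h.2
  have h₄ : θ.toSetoid z y := H hθ hψ h.1 (ψ.toSetoid.symm h₁) (ψ.toSetoid.refl y) h₂
  have h₅ : (θ ⊓ ψ).toSetoid x z := ⟨θ.toSetoid.trans h.1 (θ.toSetoid.symm h₄), h₁⟩
  have h₆ : (θ ⊓ φ).toSetoid z y := ⟨h₄, h₃⟩
  rw [sup_comm]
  exact sup_rel_of h₅ h₆

end Congruence

variable [L.IsAlgebraic] {E : Set (Identity L)}

/-- With `π` as in `SatisfiesStar`, `π(x, y, a, b)` holds as it does in `A/φ`, where `x = a` and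
`y = b`, and in `A/φ'`, where `x = y`. Modulo a factor congruence with `a = b` it then gives
`x = y`. -/
theorem decompositionsRespectFactors_of_satisfiesStar {π : L.Formula (Fin 4)}
    (hF : PreservedByFactors.{u, v, w} E π) (hP : PreservedByProducts.{u, v, w} E π)
    (hS : SatisfiesStar.{u, v, w} E π) [Nonempty A] (hA : IsModel E A) :
    Congruence.DecompositionsRespectFactors L A := by
  intro θ φ φ' ⟨θ', hθ⟩ hφ a b x y hab hxa hyb hxy
  have comp : ∀ χ : Congruence L A, (fun k => χ.toQuot (![x, y, a, b] k)) =
      ![χ.toQuot x, χ.toQuot y, χ.toQuot a, χ.toQuot b] := fun χ => by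
    funext k
    fin_cases k <;> rfl
  have h : π.Realize ![x, y, a, b] := by
    rw [realize_iff_quot hF hP hA hφ, comp, comp, Congruence.toQuot_eq_iff.2 hxa,
      Congruence.toQuot_eq_iff.2 hyb, Congruence.toQuot_eq_iff.2 hxy]
    exact ⟨(hS _ (φ.isModel_quot hA)).1 _ _, (hS _ (φ'.isModel_quot hA)).2.1 _ _ _⟩
  have h' := ((realize_iff_quot hF hP hA hθ _).1 h).1
  rw [comp, Congruence.toQuot_eq_iff.2 hab] at h'
  exact Congruence.toQuot_eq_iff.1 ((hS _ (θ.isModel_quot hA)).2.2 _ _ _ h')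

theorem hasBFC_of_satisfiesStar {π : L.Formula (Fin 4)}
    (hF : PreservedByFactors.{u, v, w} E π) (hP : PreservedByProducts.{u, v, w} E π)
    (hS : SatisfiesStar.{u, v, w} E π) : HasBFC.{u, v, w} E := by
  intro A _ _ hA
  have H := decompositionsRespectFactors_of_satisfiesStar hF hP hS hA
  refine ⟨⟨Congruence.factorCongruences L A, ?_, ?_⟩, rfl, ?_⟩
  · rintro θ ⟨θ', hθ⟩ φ ⟨φ', hφ⟩
    exact ⟨_, H.isComplementaryFactor_sup hθ hφ⟩
  · rintro θ ⟨θ', hθ⟩ φ ⟨φ', hφ⟩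
    exact ⟨_, (H.isComplementaryFactor_sup hθ.symm hφ.symm).symm⟩
  · rintro θ hθ φ hφ ψ ⟨ψ', hψ⟩
    exact le_antisymm (H.inf_sup_le hθ hφ hψ) le_inf_sup

end BFC

/-! ### Reduced products and factorable formulas -/

section ReducedProduct

variable {L : FirstOrder.Language.{u, v}} {ι : Type w} (F : Filter ι) {A : ι → Type w}
  [∀ i, L.Structure (A i)]

/-- The congruence on a direct product relating `x` and `y` when `x i` and `y i` are related modulo
`θ i` for `F`-almost all `i`. -/
def reducedCongruence (θ : ∀ i, Congruence L (A i)) : Congruence L (∀ i, A i) where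
  r x y := ∀ᶠ i in F, (θ i).toSetoid (x i) (y i)
  iseqv := ⟨fun x => .of_forall fun i => (θ i).toSetoid.refl (x i),
    fun h => h.mono fun i => (θ i).toSetoid.symm, fun h h' => by
      filter_upwards [h, h'] with i using (θ i).toSetoid.trans⟩
  compatible f x y h := by
    filter_upwards [eventually_all.2 h] with i hi using (θ i).compatible f _ _ hi

theorem reducedCongruence_bot_le (θ : ∀ i, Congruence L (A i)) :
    reducedCongruence F (fun i => (⊥ : Congruence L (A i))) ≤ reducedCongruence F θ :=
  fun _ _ h => Eventually.mono h fun i hi => (bot_le : ⊥ ≤ θ i) hi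

variable (L A) in
/-- The reduced product of a family of algebras modulo a filter. -/
abbrev ReducedProduct : Type w :=
  (reducedCongruence F fun i => (⊥ : Congruence L (A i))).Quot

variable (L) in
/-- The element of the reduced product represented by an element of the direct product. -/
abbrev toReduced (x : ∀ i, A i) : ReducedProduct L F A :=
  (reducedCongruence F fun i => (⊥ : Congruence L (A i))).toQuot x

theorem toReduced_eq_iff {x y : ∀ i, A i} :
    toReduced L F x = toReduced L F y ↔ ∀ᶠ i in F, x i = y i :=
  Congruence.toQuot_eq_iff

theorem toReduced_surjective {α : Type*} (a : α → ReducedProduct L F A) :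
    ∃ b : α → ∀ i, A i, (fun k => toReduced L F (b k)) = a :=
  (Congruence.toQuot_surjective _).comp_left a

end ReducedProduct

section Factorable

variable {L : FirstOrder.Language.{u, v}} {α : Type*}

/-- A formula is factorable if it satisfies Łoś's theorem for reduced products modulo arbitrary
filters (in place of ultrafilters). -/
def IsFactorable (φ : L.Formula α) : Prop :=
  ∀ (ι : Type w) (F : Filter ι) (A : ι → Type w) [∀ i, L.Structure (A i)] [∀ i, Nonempty (A i)]
    (a : α → ∀ i, A i),
    (φ.Realize fun k => toReduced L F (a k)) ↔ ∀ᶠ i in F, φ.Realize fun k => a k i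

theorem isFactorable_top : IsFactorable.{u, v, w} (⊤ : L.Formula α) := by
  intro ι F A _ _ a
  simp [Formula.realize_top]

theorem IsFactorable.inf {φ ψ : L.Formula α} (hφ : IsFactorable.{u, v, w} φ)
    (hψ : IsFactorable.{u, v, w} ψ) : IsFactorable.{u, v, w} (φ ⊓ ψ) := by
  intro ι F A _ _ a
  simp only [Formula.realize_inf, eventually_and]
  exact and_congr (hφ ι F A a) (hψ ι F A a)

theorem IsFactorable.relabel {β : Type*} {φ : L.Formula α} (hφ : IsFactorable.{u, v, w} φ)
    (g : α → β) : IsFactorable.{u, v, w} (φ.relabel g) := by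
  intro ι F A _ _ a
  simp only [Formula.realize_relabel]
  exact hφ ι F A _

/-- For `ψ = φ` this is closure under existential quantification. The existential conjunct is
needed: a bare implication need not pass from a product to its factors. -/
theorem IsFactorable.iExs_inf_iAlls {β : Type*} [Finite β] {φ ψ : L.Formula (α ⊕ β)}
    (hφ : IsFactorable.{u, v, w} φ) (hψ : IsFactorable.{u, v, w} ψ) :
    IsFactorable.{u, v, w} (φ.iExs β ⊓ (φ.imp ψ).iAlls β) := by
  classical
  intro ι F A _ _ a
  have hred : ∀ {χ : L.Formula (α ⊕ β)}, IsFactorable.{u, v, w} χ → ∀ b : β → ∀ i, A i,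
      (χ.Realize (Sum.elim (fun k => toReduced L F (a k)) fun k => toReduced L F (b k)) ↔
        ∀ᶠ i in F, χ.Realize (Sum.elim (fun k => a k i) fun k => b k i)) := by
    intro χ hχ b
    have h := hχ ι F A (Sum.elim a b)
    have h₁ : (fun k => toReduced L F (Sum.elim a b k)) =
        Sum.elim (fun k => toReduced L F (a k)) fun k => toReduced L F (b k) :=
      funext fun k => by cases k <;> rfl
    have h₂ : ∀ i, (fun k => Sum.elim a b k i) = Sum.elim (fun k => a k i) fun k => b k i :=
      fun i => funext fun k => by cases k <;> rfl
    simpa only [h₁, h₂] using h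
  simp only [Formula.realize_inf, Formula.realize_iExs, Formula.realize_iAlls,
    Formula.realize_imp]
  constructor
  · rintro ⟨⟨b, hb⟩, h⟩
    obtain ⟨b, rfl⟩ := toReduced_surjective F b
    -- at each coordinate, a counterexample to `φ → ψ` if there is one, otherwise a witness of `φ`
    have hc : ∀ i, ∃ c : β → A i,
        (φ.Realize (Sum.elim (fun k => a k i) fun k => b k i) →
          φ.Realize (Sum.elim (fun k => a k i) c)) ∧
        (ψ.Realize (Sum.elim (fun k => a k i) c) →
          ∀ d : β → A i, φ.Realize (Sum.elim (fun k => a k i) d) →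
            ψ.Realize (Sum.elim (fun k => a k i) d)) := by
      intro i
      by_cases h' : ∃ d : β → A i, φ.Realize (Sum.elim (fun k => a k i) d) ∧
          ¬ ψ.Realize (Sum.elim (fun k => a k i) d)
      · obtain ⟨d, h₁, h₂⟩ := h'
        exact ⟨d, fun _ => h₁, fun h => absurd h h₂⟩
      · push Not at h'
        exact ⟨fun k => b k i, fun h => h, fun _ => h'⟩
    choose c hc₁ hc₂ using hc
    rw [hred hφ] at hb
    have hφc := (hred hφ fun k i => c i k).2 (hb.mono fun i => hc₁ i)
    have hψc := (hred hψ fun k i => c i k).1 (h _ hφc)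
    filter_upwards [hb, hψc] with i hi hi'
    exact ⟨⟨_, hi⟩, hc₂ i hi'⟩
  · intro h
    refine ⟨?_, fun b hb => ?_⟩
    · have hc : ∀ i, ∃ c : β → A i,
          (∃ d : β → A i, φ.Realize (Sum.elim (fun k => a k i) d)) →
            φ.Realize (Sum.elim (fun k => a k i) c) := by
        intro i
        by_cases h' : ∃ d : β → A i, φ.Realize (Sum.elim (fun k => a k i) d)
        · obtain ⟨d, hd⟩ := h'
          exact ⟨d, fun _ => hd⟩
        · exact ⟨fun _ => Classical.arbitrary _, fun h => absurd h h'⟩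
      choose c hc using hc
      exact ⟨_, (hred hφ fun k i => c i k).2 (h.mono fun i hi => hc i hi.1)⟩
    · obtain ⟨b, rfl⟩ := toReduced_surjective F b
      have hb := (hred hφ b).1 hb
      refine (hred hψ b).2 ?_
      filter_upwards [h, hb] with i hi hi' using hi.2 _ hi'

variable [L.IsAlgebraic]

theorem isFactorable_equal (s t : L.Term α) : IsFactorable.{u, v, w} (s.equal t) := by
  intro ι F A _ _ a
  simp only [Formula.realize_equal]
  have h : ∀ t : L.Term α, t.realize (fun k => toReduced L F (a k)) =
      toReduced L F (t.realize a) := fun t => Congruence.realize_term_quot _ t a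
  rw [h, h, toReduced_eq_iff]
  simp only [realize_term_pi]

/-- For the filter `⊤`, whose only member is the whole index set, the reduced product is the direct
product. -/
theorem IsFactorable.realize_pi_iff {φ : L.Formula α} (hφ : IsFactorable.{u, v, w} φ)
    {ι : Type w} {A : ι → Type w} [∀ i, L.Structure (A i)] [∀ i, Nonempty (A i)]
    (a : α → ∀ i, A i) : φ.Realize a ↔ ∀ i, φ.Realize fun k => a k i := by
  have hg : Function.Bijective
      (reducedCongruence ⊤ fun i => (⊥ : Congruence L (A i))).quotHom := by
    refine ⟨fun x y h => ?_, Congruence.toQuot_surjective _⟩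
    funext i
    exact eventually_top.1 ((toReduced_eq_iff _).1 h) i
  rw [← StrongHomClass.realize_formula (equivOfBijective _ hg) φ, ← eventually_top]
  exact hφ ι ⊤ A a

theorem IsFactorable.preservedByProducts {E : Set (Identity L)} {α : Type} {φ : L.Formula α}
    (hφ : IsFactorable.{u, v, w} φ) : PreservedByProducts.{u, v, w} E φ :=
  fun _ _ _ _ _ a h => (hφ.realize_pi_iff a).2 h

theorem IsFactorable.preservedByFactors {E : Set (Identity L)} {α : Type} {φ : L.Formula α}
    (hφ : IsFactorable.{u, v, w} φ) : PreservedByFactors.{u, v, w} E φ := by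
  intro A B _ _ _ _ _ _ a h
  rw [realize_prod_iff_pairElem, hφ.realize_pi_iff] at h
  exact ⟨h ⟨true⟩, h ⟨false⟩⟩

end Factorable

/-! ### Extending maps that preserve factorable formulas -/

section Extension

variable {L : FirstOrder.Language.{u, v}} {P : Type*}

/-- The tuples `a` and `b`, indexed by the same type, satisfy the same factorable formulas. -/
def FactorablyEquiv {A B : Type w} [L.Structure A] [L.Structure B] (a : P → A) (b : P → B) : Prop :=
  ∀ φ : L.Formula P, IsFactorable.{u, v, w} φ → (φ.Realize a ↔ φ.Realize b)

theorem realize_congr_of_eqOn_freeVarFinset {A : Type w} [L.Structure A] {α : Type*}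
    [DecidableEq α] (φ : L.Formula α) {a b : α → A}
    (h : ∀ k ∈ BoundedFormula.freeVarFinset φ, a k = b k) :
    φ.Realize a ↔ φ.Realize b := by
  have key : ∀ c : α → A, (∀ k ∈ BoundedFormula.freeVarFinset φ, a k = c k) →
      ((BoundedFormula.restrictFreeVar φ id).Realize (fun k => a k) default ↔
        φ.Realize c) := fun c hc =>
    BoundedFormula.realize_restrictFreeVar (f := id) c fun k => hc k k.2
  rw [← key a fun _ _ => rfl, ← key b h]

/-- For a class `Q` of formulas closed under conjunction and a family of tuples `t`, the filter
generated by the sets of indices at which a formula in `Q` is true. -/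
def realizationFilter {α κ : Type*} (Q : L.Formula α → Prop) (htop : Q ⊤)
    (hinf : ∀ {φ ψ}, Q φ → Q ψ → Q (φ ⊓ ψ)) {A : κ → Type w} [∀ k, L.Structure (A k)]
    (t : ∀ k, α → A k) : Filter κ where
  sets := {S | ∃ φ, Q φ ∧ ∀ k, φ.Realize (t k) → k ∈ S}
  univ_sets := ⟨⊤, htop, fun _ _ => trivial⟩
  sets_of_superset := fun ⟨φ, h₁, h₂⟩ h => ⟨φ, h₁, fun k hk => h (h₂ k hk)⟩
  inter_sets := fun ⟨φ, h₁, h₂⟩ ⟨ψ, h₁', h₂'⟩ => ⟨φ ⊓ ψ, hinf h₁ h₁', fun k hk =>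
    ⟨h₂ k (Formula.realize_inf.1 hk).1, h₂' k (Formula.realize_inf.1 hk).2⟩⟩

variable {A B : Type w} [L.Structure A] [L.Structure B]

/-- The maps `B → A` that carry the tuple `b` to the tuple `a`. -/
def TupleMap (a : P → A) (b : P → B) : Type w := {g : B → A // g ∘ b = a}

variable [L.IsAlgebraic] [Nonempty B] {a : P → A} {b : P → B}

/-- Every factorable formula true in `B`, with the elements of `B` as variables, can be made true
in `A` while any prescribed one that fails in `B` is made false. -/
theorem FactorablyEquiv.exists_tupleMap (h : FactorablyEquiv (L := L) a b) {φ ψ : L.Formula B}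
    (hφ : IsFactorable.{u, v, w} φ) (hψ : IsFactorable.{u, v, w} ψ) (hφB : φ.Realize id)
    (hψB : ¬ ψ.Realize (id : B → B)) :
    ∃ g : TupleMap a b, φ.Realize g.1 ∧ ¬ ψ.Realize g.1 := by
  classical
  let s : Finset B := BoundedFormula.freeVarFinset φ ∪ BoundedFormula.freeVarFinset ψ
  -- elements of the tuple are kept as parameters, the other variables that occur are quantified,
  -- and `none` stands for all variables that do not occur
  let ρ : B → P ⊕ Option s := fun x =>
    if hx : ∃ p, b p = x then .inl hx.choose
    else if hs : x ∈ s then .inr (some ⟨x, hs⟩) else .inr none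
  have hρ : ∀ p, ∃ p', ρ (b p) = .inl p' ∧ b p' = b p := fun p => by
    have hx : ∃ p', b p' = b p := ⟨p, rfl⟩
    exact ⟨hx.choose, dif_pos hx, hx.choose_spec⟩
  let t : Option s → B := fun o => o.elim (Classical.arbitrary B) fun x => x
  have ht : ∀ x ∈ s, Sum.elim b t (ρ x) = x := by
    intro x hx
    by_cases hx' : ∃ p, b p = x
    · obtain ⟨p, rfl⟩ := hx'
      obtain ⟨p', hp', hb⟩ := hρ p
      rw [hp']
      exact hb
    · simp only [ρ, dif_neg hx', dif_pos hx]
      rfl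
  have hreal : ∀ χ : L.Formula B, BoundedFormula.freeVarFinset χ ⊆ s →
      ((χ.relabel ρ).Realize (Sum.elim b t) ↔ χ.Realize id) := by
    intro χ hχ
    rw [Formula.realize_relabel]
    exact realize_congr_of_eqOn_freeVarFinset χ fun k hk => ht k (hχ hk)
  have hφt := (hreal φ Finset.subset_union_left).2 hφB
  have hψt := mt (hreal ψ Finset.subset_union_right).1 hψB
  have hex := (h _ ((hφ.relabel ρ).iExs_inf_iAlls (hφ.relabel ρ))).2 (by
    simp only [Formula.realize_inf, Formula.realize_iExs, Formula.realize_iAlls,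
      Formula.realize_imp]
    exact ⟨⟨t, hφt⟩, fun _ h => h⟩)
  have hall := mt (h _ ((hφ.relabel ρ).iExs_inf_iAlls (hψ.relabel ρ))).1 (by
    simp only [Formula.realize_inf, Formula.realize_iExs, Formula.realize_iAlls,
      Formula.realize_imp]
    exact fun h' => hψt (h'.2 t hφt))
  simp only [Formula.realize_inf, Formula.realize_iExs, Formula.realize_iAlls,
    Formula.realize_imp] at hex hall
  obtain ⟨d, hd, hd'⟩ : ∃ d : Option s → A, (φ.relabel ρ).Realize (Sum.elim a d) ∧
      ¬ (ψ.relabel ρ).Realize (Sum.elim a d) := by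
    by_contra! hcon
    exact hall ⟨hex.1, hcon⟩
  rw [Formula.realize_relabel] at hd hd'
  refine ⟨⟨Sum.elim a d ∘ ρ, ?_⟩, hd, hd'⟩
  funext p
  obtain ⟨p', hp', hb⟩ := hρ p
  have := (h ((Term.var p').equal (Term.var p)) (isFactorable_equal _ _)).2
    (by simpa [Formula.realize_equal] using hb)
  simpa [Formula.realize_equal, hp'] using this

/-- The filter on the maps carrying `b` to `a` generated by the sets of maps making a factorable
formula true that holds in `B`. -/
def tupleMapFilter (a : P → A) (b : P → B) : Filter (TupleMap a b) :=
  realizationFilter (fun φ : L.Formula B => IsFactorable.{u, v, w} φ ∧ φ.Realize id)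
    ⟨isFactorable_top, Formula.realize_top.2 trivial⟩
    (fun h h' => ⟨h.1.inf h'.1, Formula.realize_inf.2 ⟨h.2, h'.2⟩⟩) fun g => g.1

/-- If `a` and `b` satisfy the same factorable formulas, then `B` maps, preserving and reflecting
factorable formulas, into a reduced power of `A`. -/
theorem FactorablyEquiv.extend [Nonempty A] (h : FactorablyEquiv (L := L) a b) :
    FactorablyEquiv (L := L) (id : B → B) fun x =>
      toReduced L (tupleMapFilter (L := L) a b) fun g => g.1 x := by
  intro φ hφ
  rw [hφ]
  refine ⟨fun hB => ⟨φ, ⟨hφ, hB⟩, fun _ h => h⟩, fun ⟨φ', ⟨hφ', hB⟩, hsub⟩ => ?_⟩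
  by_contra hcon
  obtain ⟨g, h₁, h₂⟩ := h.exists_tupleMap hφ' hφ hB hcon
  exact h₂ (hsub g h₁)

end Extension

/-! ### Algebras with a pair of complementary factor congruences -/

/-- An algebra in the variety axiomatized by `E` with a pair of complementary factor congruences,
that is, up to isomorphism, an algebra of the variety together with a decomposition as a direct
product of two factors. -/
structure FactoredAlgebra {L : FirstOrder.Language.{u, v}} (E : Set (Identity L)) where
  /-- The underlying type. -/
  carrier : Type w
  [str : L.Structure carrier]
  [nonempty : Nonempty carrier]
  isModel : IsModel E carrier
  /-- The kernel of the projection to the first factor. -/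
  left : Congruence L carrier
  /-- The kernel of the projection to the second factor. -/
  right : Congruence L carrier
  compl : left.IsComplementaryFactor right

attribute [instance] FactoredAlgebra.str FactoredAlgebra.nonempty

namespace FactoredAlgebra

variable {L : FirstOrder.Language.{u, v}} [L.IsAlgebraic] {E : Set (Identity L)} {ι : Type w}

/-- A reduced product of algebras with a pair of complementary factor congruences. -/
noncomputable def reducedProduct (F : Filter ι) (A : ι → FactoredAlgebra.{u, v, w} E) :
    FactoredAlgebra.{u, v, w} E where
  carrier := ReducedProduct L F fun i => (A i).carrier
  isModel := Congruence.isModel_quot _ (.pi fun i => (A i).isModel)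
  left := Congruence.push _ _ (reducedCongruence_bot_le F fun i => (A i).left)
  right := Congruence.push _ _ (reducedCongruence_bot_le F fun i => (A i).right)
  compl := by
    refine .of_rel (fun x y h₁ h₂ => ?_) fun x y => ?_
    all_goals
      obtain ⟨x, rfl⟩ := Congruence.toQuot_surjective _ x
      obtain ⟨y, rfl⟩ := Congruence.toQuot_surjective _ y
    · rw [Congruence.push_toQuot] at h₁ h₂
      refine (toReduced_eq_iff F).2 ?_
      filter_upwards [h₁, h₂] with i using (A i).compl.eq_of_rel
    · choose z h₁ h₂ using fun i => (A i).compl.2 (x i) (y i)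
      exact ⟨toReduced L F z, (Congruence.push_toQuot _ _ _).2 (.of_forall h₁),
        (Congruence.push_toQuot _ _ _).2 (.of_forall h₂)⟩

variable {F : Filter ι} {A : ι → FactoredAlgebra.{u, v, w} E} {x y : ∀ i, (A i).carrier}

theorem reducedProduct_left_iff :
    (reducedProduct F A).left.toSetoid (toReduced L F x) (toReduced L F y) ↔
      ∀ᶠ i in F, (A i).left.toSetoid (x i) (y i) :=
  Congruence.push_toQuot (reducedCongruence_bot_le F fun i => (A i).left) _ _

theorem reducedProduct_right_iff :
    (reducedProduct F A).right.toSetoid (toReduced L F x) (toReduced L F y) ↔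
      ∀ᶠ i in F, (A i).right.toSetoid (x i) (y i) :=
  Congruence.push_toQuot (reducedCongruence_bot_le F fun i => (A i).right) _ _

end FactoredAlgebra

/-! ### Unions of chains -/

section Union

variable {L : FirstOrder.Language.{u, v}} {E : Set (Identity L)} {X : Type w}
  [L.Structure X] {A : ℕ → Type w} [∀ n, L.Structure (A n)]

/-- `X` is the union of the chain of algebras `A n`, with embeddings `i n` into `X` and connecting
maps `d n`. -/
structure IsChainUnion (d : ∀ n, A n → A (n + 1)) (i : ∀ n, A n ↪[L] X) : Prop where
  compat : ∀ n x, i (n + 1) (d n x) = i n x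
  exists_eq : ∀ x, ∃ n a, i n a = x

namespace IsChainUnion

variable {d : ∀ n, A n → A (n + 1)} {i : ∀ n, A n ↪[L] X} (h : IsChainUnion d i)

include h

theorem exists_lift {m n : ℕ} (hmn : m ≤ n) (x : A m) : ∃ y, i n y = i m x := by
  induction n, hmn using Nat.le_induction with
  | base => exact ⟨x, rfl⟩
  | succ n _ ih =>
    obtain ⟨y, hy⟩ := ih
    exact ⟨d n y, (h.compat n y).trans hy⟩

theorem exists_common {κ : Type*} [Finite κ] (x : κ → X) :
    ∃ (N : ℕ) (y : κ → A N), ∀ k, i N (y k) = x k := by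
  choose n a ha using fun k => h.exists_eq (x k)
  obtain ⟨N, hN⟩ := (Set.finite_range n).bddAbove
  choose y hy using fun k => h.exists_lift (hN ⟨k, rfl⟩) (a k)
  exact ⟨N, y, fun k => (hy k).trans (ha k)⟩

theorem rel_iff {R : ∀ n, A n → A n → Prop} (hR : ∀ n x y, R (n + 1) (d n x) (d n y) ↔ R n x y)
    {m n : ℕ} (hmn : m ≤ n) {x y : A m} {x' y' : A n} (hx : i n x' = i m x)
    (hy : i n y' = i m y) : R n x' y' ↔ R m x y := by
  induction n, hmn using Nat.le_induction with
  | base => rw [(i m).injective hx, (i m).injective hy]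
  | succ n hmn ih =>
    obtain ⟨x'', hx''⟩ := h.exists_lift hmn x
    obtain ⟨y'', hy''⟩ := h.exists_lift hmn y
    obtain rfl : d n x'' = x' :=
      (i (n + 1)).injective ((h.compat n x'').trans (hx''.trans hx.symm))
    obtain rfl : d n y'' = y' :=
      (i (n + 1)).injective ((h.compat n y'').trans (hy''.trans hy.symm))
    rw [hR, ih hx'' hy'']

theorem isModel [∀ n, Nonempty (A n)] (hA : ∀ n, IsModel E (A n)) : IsModel E X := by
  classical
  intro e he a
  let s := BoundedFormula.freeVarFinset (e.1.equal e.2)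
  obtain ⟨N, y, hy⟩ := h.exists_common fun k : s => a k
  let b : ℕ → A N := fun k => if hk : k ∈ s then y ⟨k, hk⟩ else Classical.arbitrary _
  rw [← Formula.realize_equal, realize_congr_of_eqOn_freeVarFinset (e.1.equal e.2) (b := i N ∘ b),
    Formula.realize_equal, HomClass.realize_term, HomClass.realize_term, hA N e he]
  intro k hk
  simp only [Function.comp_apply, b]
  rw [dif_pos hk, hy]

/-- Congruences of the members of a chain that are compatible with the connecting maps have a
union. -/
theorem exists_congruence (θ : ∀ n, Congruence L (A n))
    (hθ : ∀ n x y, (θ (n + 1)).toSetoid (d n x) (d n y) ↔ (θ n).toSetoid x y) :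
    ∃ Θ : Congruence L X, ∀ n x y, Θ.toSetoid (i n x) (i n y) ↔ (θ n).toSetoid x y := by
  let r : X → X → Prop := fun x y => ∃ n a b, i n a = x ∧ i n b = y ∧ (θ n).toSetoid a b
  have hr : ∀ n x y, r (i n x) (i n y) ↔ (θ n).toSetoid x y := by
    refine fun n x y => ⟨fun ⟨m, a, b, ha, hb, hab⟩ => ?_, fun h => ⟨n, x, y, rfl, rfl, h⟩⟩
    obtain ⟨x', hx'⟩ := h.exists_lift (le_max_left n m) x
    obtain ⟨y', hy'⟩ := h.exists_lift (le_max_left n m) y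
    exact (h.rel_iff (R := fun n x y => (θ n).toSetoid x y) hθ (le_max_left n m) hx' hy').1
      ((h.rel_iff (R := fun n x y => (θ n).toSetoid x y) hθ (le_max_right n m)
        (hx'.trans ha.symm) (hy'.trans hb.symm)).2 hab)
  refine ⟨{ r := r, iseqv := ⟨fun x => ?_, fun {x y} hxy => ?_, fun {x y z} hxy hyz => ?_⟩,
            compatible := fun {n} f x y hxy => ?_ }, hr⟩
  · obtain ⟨n, a, rfl⟩ := h.exists_eq x
    exact (hr n a a).2 ((θ n).toSetoid.refl a)
  · obtain ⟨n, a, b, rfl, rfl, hab⟩ := hxy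
    exact (hr n b a).2 ((θ n).toSetoid.symm hab)
  · obtain ⟨N, a, ha⟩ := h.exists_common ![x, y, z]
    obtain rfl : i N (a 0) = x := ha 0
    obtain rfl : i N (a 1) = y := ha 1
    obtain rfl : i N (a 2) = z := ha 2
    exact (hr N _ _).2 ((θ N).toSetoid.trans ((hr N _ _).1 hxy) ((hr N _ _).1 hyz))
  · obtain ⟨N, a, ha⟩ := h.exists_common (Sum.elim x y)
    obtain rfl : (fun k => i N (a (.inl k))) = x := funext fun k => ha (.inl k)
    obtain rfl : (fun k => i N (a (.inr k))) = y := funext fun k => ha (.inr k)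
    have hf : ∀ b : Fin n → A N,
        Structure.funMap f (fun k => i N (b k)) = i N (Structure.funMap f b) :=
      fun b => ((i N).map_fun f b).symm
    rw [hf, hf]
    exact (hr N _ _).2 ((θ N).compatible f _ _ fun k => (hr N _ _).1 (hxy k))

end IsChainUnion

theorem IsChainUnion.exists_factors {A : ℕ → FactoredAlgebra.{u, v, w} E}
    {d : ∀ n, (A n).carrier → (A (n + 1)).carrier} {i : ∀ n, (A n).carrier ↪[L] X}
    (h : IsChainUnion d i)
    (hl : ∀ n x y, (A (n + 1)).left.toSetoid (d n x) (d n y) ↔ (A n).left.toSetoid x y)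
    (hr : ∀ n x y, (A (n + 1)).right.toSetoid (d n x) (d n y) ↔ (A n).right.toSetoid x y) :
    ∃ θ ψ : Congruence L X, θ.IsComplementaryFactor ψ ∧
      (∀ n x y, θ.toSetoid (i n x) (i n y) ↔ (A n).left.toSetoid x y) ∧
      ∀ n x y, ψ.toSetoid (i n x) (i n y) ↔ (A n).right.toSetoid x y := by
  obtain ⟨θ, hθ⟩ := h.exists_congruence (fun n => (A n).left) hl
  obtain ⟨ψ, hψ⟩ := h.exists_congruence (fun n => (A n).right) hr
  refine ⟨θ, ψ, .of_rel (fun x y h₁ h₂ => ?_) fun x y => ?_, hθ, hψ⟩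
  all_goals
    obtain ⟨N, a, ha⟩ := h.exists_common ![x, y]
    obtain rfl : i N (a 0) = x := ha 0
    obtain rfl : i N (a 1) = y := ha 1
  · rw [(A N).compl.eq_of_rel ((hθ _ _ _).1 h₁) ((hψ _ _ _).1 h₂)]
  · obtain ⟨z, h₁, h₂⟩ := (A N).compl.2 (a 0) (a 1)
    exact ⟨i N z, (hθ _ _ _).2 h₁, (hψ _ _ _).2 h₂⟩

end Union

/-! ### The alternating chain -/

section Alternating

variable {L : FirstOrder.Language.{u, v}} {E : Set (Identity L)}

/-- Two algebras with factor congruences and a map between them that preserves and reflects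
factorable formulas. The map need not respect the factor congruences. -/
structure FactorableExtension (E : Set (Identity L)) where
  /-- The smaller algebra. -/
  dom : FactoredAlgebra.{u, v, w} E
  /-- The larger algebra. -/
  cod : FactoredAlgebra.{u, v, w} E
  /-- The map. -/
  map : dom.carrier → cod.carrier
  factorablyEquiv : FactorablyEquiv (L := L) id map

namespace FactorableExtension

variable [L.IsAlgebraic]

theorem map_injective (s : FactorableExtension.{u, v, w} E) : Function.Injective s.map := by
  intro x y hxy
  have := (s.factorablyEquiv ((Term.var x).equal (Term.var y)) (isFactorable_equal _ _)).2
    (by simpa [Formula.realize_equal] using hxy)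
  simpa [Formula.realize_equal] using this

/-- The map of a factorable extension is an embedding of algebras: that an operation takes given
values is expressed by equations, which are factorable. -/
def emb (s : FactorableExtension.{u, v, w} E) : s.dom.carrier ↪[L] s.cod.carrier :=
  Embedding.ofInjective (f := homOfMapFun s.map fun f x => by
    have := (s.factorablyEquiv ((Term.func f fun k => Term.var (x k)).equal
      (Term.var (Structure.funMap f x))) (isFactorable_equal _ _)).1
        (by simp [Formula.realize_equal])
    simp only [Formula.realize_equal, Term.realize_func, Term.realize_var] at this
    exact this.symm) s.map_injective

/-- From a factorable extension `A → B`, the factorable extension of `B` by a reduced power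
of `A`. -/
noncomputable def next (s : FactorableExtension.{u, v, w} E) : FactorableExtension.{u, v, w} E where
  dom := s.cod
  cod := .reducedProduct (tupleMapFilter (L := L) id s.map) fun _ => s.dom
  map x := toReduced L _ fun g => g.1 x
  factorablyEquiv := s.factorablyEquiv.extend

theorem next_map_map (s : FactorableExtension.{u, v, w} E) (x : s.dom.carrier) :
    s.next.map (s.map x) = toReduced L (tupleMapFilter (L := L) id s.map) fun _ => x :=
  congrArg (toReduced L _) (funext fun g => congrFun g.2 x)

/-- The filter of the reduced power is proper once the algebras have two elements. -/
theorem tupleMapFilter_neBot (s : FactorableExtension.{u, v, w} E) {x y : s.dom.carrier}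
    (hxy : x ≠ y) : (tupleMapFilter (L := L) id s.map).NeBot := by
  refine ⟨fun hbot => hxy (s.map_injective (s.next.map_injective ?_))⟩
  rw [next_map_map, next_map_map]
  refine (toReduced_eq_iff _).2 ?_
  rw [hbot]
  exact eventually_bot

theorem next_left_iff (s : FactorableExtension.{u, v, w} E) (x y : s.dom.carrier) :
    s.next.cod.left.toSetoid (s.next.map (s.map x)) (s.next.map (s.map y)) ↔
      s.dom.left.toSetoid x y := by
  obtain rfl | hxy := eq_or_ne x y
  · exact iff_of_true (Setoid.refl' _ _) (Setoid.refl' _ _)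
  · have := s.tupleMapFilter_neBot hxy
    rw [next_map_map, next_map_map]
    exact FactoredAlgebra.reducedProduct_left_iff.trans eventually_const

theorem next_right_iff (s : FactorableExtension.{u, v, w} E) (x y : s.dom.carrier) :
    s.next.cod.right.toSetoid (s.next.map (s.map x)) (s.next.map (s.map y)) ↔
      s.dom.right.toSetoid x y := by
  obtain rfl | hxy := eq_or_ne x y
  · exact iff_of_true (Setoid.refl' _ _) (Setoid.refl' _ _)
  · have := s.tupleMapFilter_neBot hxy
    rw [next_map_map, next_map_map]
    exact FactoredAlgebra.reducedProduct_right_iff.trans eventually_const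

/-- The chain `A → B → A* → B* → ⋯` in which each algebra, from the third on, is a reduced power of
the last but one. Its `n`-th member consists of the algebras at positions `2n` and `2n + 1`. -/
noncomputable def chain (s : FactorableExtension.{u, v, w} E) : ℕ → FactorableExtension.{u, v, w} E
  | 0 => s
  | n + 1 => (s.chain n).next.next

/-- Both algebras of a factorable extension embed in one algebra of the variety on which the factor
congruences of both extend to factor congruences: the union of the alternating chain. -/
theorem exists_common_extension (s : FactorableExtension.{u, v, w} E) :
    ∃ (X : Type w) (_ : L.Structure X) (_ : Nonempty X) (θ θ' φ φ' : Congruence L X)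
      (j : s.cod.carrier → X), IsModel E X ∧
      θ.IsComplementaryFactor θ' ∧ φ.IsComplementaryFactor φ' ∧
      (∀ x y, θ.toSetoid (j (s.map x)) (j (s.map y)) ↔ s.dom.left.toSetoid x y) ∧
      (∀ x y, φ.toSetoid (j x) (j y) ↔ s.cod.left.toSetoid x y) ∧
      ∀ x y, φ'.toSetoid (j x) (j y) ↔ s.cod.right.toSetoid x y := by
  let f : ∀ n, (s.chain n).dom.carrier ↪[L] (s.chain (n + 1)).dom.carrier := fun n =>
    (s.chain n).next.emb.comp (s.chain n).emb
  let G : ℕ → Type w := fun n => (s.chain n).dom.carrier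
  let X := Language.DirectLimit G (DirectedSystem.natLERec f)
  let i : ∀ n, (s.chain n).dom.carrier ↪[L] X := fun n => Language.DirectLimit.of L ℕ G _ n
  have hi : ∀ n x, i (n + 1) (f n x) = i n x := by
    intro n x
    have := Language.DirectLimit.of_f (L := L) (G := G) (f := DirectedSystem.natLERec f)
      (hij := Nat.le_succ n) (x := x)
    rw [← this]
    congr 1
    rw [DirectedSystem.coe_natLERec]
    exact (Nat.leRecOn_succ' (C := G) (next := fun {k} => f k) x).symm
  have hdom : IsChainUnion (fun n => f n) i := ⟨hi, fun x => Language.DirectLimit.exists_of x⟩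
  let j : ∀ n, (s.chain n).cod.carrier ↪[L] X := fun n => (i (n + 1)).comp (s.chain n).next.emb
  have hj : ∀ n x, j n ((s.chain n).map x) = i n x := hi
  have hcod : IsChainUnion (A := fun n => (s.chain n).cod.carrier)
      (fun n x => (s.chain n).next.next.map ((s.chain n).next.map x)) j := by
    refine ⟨fun n x => hj (n + 1) _, fun x => ?_⟩
    obtain ⟨n, a, rfl⟩ := hdom.exists_eq x
    exact ⟨n, _, hj n a⟩
  obtain ⟨θ, θ', hθ, hl, -⟩ := hdom.exists_factors (A := fun n => (s.chain n).dom)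
    (fun n => (s.chain n).next_left_iff) fun n => (s.chain n).next_right_iff
  obtain ⟨φ, φ', hφ, hl', hr'⟩ := hcod.exists_factors (A := fun n => (s.chain n).cod)
    (fun n => (s.chain n).next.next_left_iff) fun n => (s.chain n).next.next_right_iff
  have hlj : ∀ n x y, θ.toSetoid (j n ((s.chain n).map x)) (j n ((s.chain n).map y)) ↔
      (s.chain n).dom.left.toSetoid x y := fun n x y => by rw [hj, hj, hl]
  refine ⟨X, inferInstance, ⟨i 0 (Classical.arbitrary _)⟩, θ, θ', φ, φ', j 0,
    hdom.isModel fun n => (s.chain n).dom.isModel, hθ, hφ, hlj 0, hl' 0, hr' 0⟩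

end FactorableExtension

end Alternating

/-! ### Boolean factor congruences yield the formula -/

section Formula

variable {L : FirstOrder.Language.{u, v}} [L.IsAlgebraic] {E : Set (Identity L)}

/-- If `A` is decomposed as `A₁ × A₂`, the tuple `a` has the form `(x, y, x, y)` in the second
factor and `(x, x, z, w)` in the first. -/
def IsMixedTuple (A : FactoredAlgebra.{u, v, w} E) (a : Fin 4 → A.carrier) : Prop :=
  A.left.toSetoid (a 0) (a 1) ∧ A.right.toSetoid (a 0) (a 2) ∧ A.right.toSetoid (a 1) (a 3)

/-- With Boolean factor congruences, factorable formulas cannot separate a mixed tuple from a tuple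
`(x, y, z, w)` for which some factor congruence identifies `z` and `w` but not `x` and `y`. -/
theorem HasBFC.left_rel_of_factorablyEquiv (hE : HasBFC.{u, v, w} E)
    {A B : FactoredAlgebra.{u, v, w} E} {a : Fin 4 → A.carrier} {b : Fin 4 → B.carrier}
    (hab : FactorablyEquiv (L := L) a b) (ha : IsMixedTuple A a)
    (hb : B.left.toSetoid (b 2) (b 3)) : B.left.toSetoid (b 0) (b 1) := by
  let s : FactorableExtension E :=
    { dom := B
      cod := .reducedProduct (tupleMapFilter (L := L) a b) fun _ => A
      map := fun x => toReduced L _ fun g => g.1 x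
      factorablyEquiv := hab.extend }
  have hs : ∀ k, s.map (b k) = toReduced L (tupleMapFilter (L := L) a b) fun _ => a k :=
    fun k => congrArg (toReduced L _) (funext fun g => congrFun g.2 k)
  obtain ⟨X, _, _, θ, θ', φ, φ', j, hX, hθ, hφ, hl, hl', hr'⟩ := s.exists_common_extension
  have h₁ : φ.toSetoid (j (s.map (b 0))) (j (s.map (b 1))) := by
    rw [hl', hs, hs]
    exact FactoredAlgebra.reducedProduct_left_iff.2 (.of_forall fun _ => ha.1)
  have h₂ : φ'.toSetoid (j (s.map (b 0))) (j (s.map (b 2))) := by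
    rw [hr', hs, hs]
    exact FactoredAlgebra.reducedProduct_right_iff.2 (.of_forall fun _ => ha.2.1)
  have h₃ : φ'.toSetoid (j (s.map (b 1))) (j (s.map (b 3))) := by
    rw [hr', hs, hs]
    exact FactoredAlgebra.reducedProduct_right_iff.2 (.of_forall fun _ => ha.2.2)
  have h₄ : θ.toSetoid (j (s.map (b 2))) (j (s.map (b 3))) := (hl _ _).2 hb
  refine (hl _ _).1 ?_
  obtain ⟨S, hS, hdist⟩ := hE X hX
  have hmem : ∀ {χ χ' : Congruence L X}, χ.IsComplementaryFactor χ' → χ ∈ S := fun h => by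
    rw [← SetLike.mem_coe, hS]
    exact ⟨_, h⟩
  have h₅ : (φ ⊓ (φ' ⊔ θ)).toSetoid (j (s.map (b 0))) (j (s.map (b 1))) :=
    ⟨h₁, (φ' ⊔ θ).toSetoid.trans (Congruence.sup_rel_of h₂ h₄)
      ((le_sup_left : φ' ≤ φ' ⊔ θ) (φ'.toSetoid.symm h₃))⟩
  rw [hdist φ (hmem hφ) φ' (hmem hφ.symm) θ (hmem hθ), hφ.1, bot_sup_eq] at h₅
  exact h₅.2

/-- In an algebraic language the formulas in finitely many variables can be indexed by a type in the
universe of the operation symbols, as there are no relation symbols. -/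
theorem small_formula : Small.{max u w} (L.Formula (Fin 4)) := by
  have : IsEmpty (Σ n, L.Relations n) := ⟨fun r => isEmptyElim r.2⟩
  have h₁ : Small.{u} (Σ k, L.Term (Fin 4 ⊕ Fin k)) := inferInstance
  have h : Small.{u} (L.Formula (Fin 4)) :=
    small_of_injective (β := List ((Σ k, L.Term (Fin 4 ⊕ Fin k)) ⊕ ((Σ n, L.Relations n) ⊕ ℕ)))
      (f := fun φ => BoundedFormula.listEncode φ) fun φ ψ h =>
        eq_of_heq (Sigma.mk.inj
          (@BoundedFormula.listEncode_sigma_injective L (Fin 4) ⟨0, φ⟩ ⟨0, ψ⟩ h)).2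
  exact small_lift _

/-- Satisfaction by all mixed tuples of the variety. -/
def HoldsOnMixedTuples (E : Set (Identity L)) (π : L.Formula (Fin 4)) : Prop :=
  ∀ (A : FactoredAlgebra.{u, v, w} E) (a : Fin 4 → A.carrier), IsMixedTuple A a → π.Realize a

/-- The algebra with the decomposition whose second factor is trivial. -/
def FactoredAlgebra.ofBot (A : Type w) [L.Structure A] [Nonempty A] (hA : IsModel E A) :
    FactoredAlgebra.{u, v, w} E where
  carrier := A
  isModel := hA
  left := ⊥
  right := ⊤
  compl := Congruence.isComplementaryFactor_top_bot.symm

/-- The algebra with the decomposition whose first factor is trivial. -/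
def FactoredAlgebra.ofTop (A : Type w) [L.Structure A] [Nonempty A] (hA : IsModel E A) :
    FactoredAlgebra.{u, v, w} E where
  carrier := A
  isModel := hA
  left := ⊤
  right := ⊥
  compl := Congruence.isComplementaryFactor_top_bot

/-- A mixed tuple in the variety that satisfies no factorable formulas other than those common to
all mixed tuples, and a tuple `(x, y, z, w)` with the same factorable theory which violates the
conclusion of `HasBFC.left_rel_of_factorablyEquiv`. -/
theorem exists_factorablyEquiv_of_forall_not [Small.{w} (L.Formula (Fin 4))]
    (h : ∀ π : L.Formula (Fin 4), IsFactorable.{u, v, w} π → HoldsOnMixedTuples.{u, v, w} E π →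
      ∃ (A : Type w) (_ : L.Structure A) (_ : Nonempty A) (x y z : A), IsModel E A ∧
        π.Realize ![x, y, z, z] ∧ x ≠ y) :
    ∃ (A B : FactoredAlgebra.{u, v, w} E) (a : Fin 4 → A.carrier) (b : Fin 4 → B.carrier),
      FactorablyEquiv (L := L) a b ∧ IsMixedTuple A a ∧ B.left.toSetoid (b 2) (b 3) ∧
      ¬ B.left.toSetoid (b 0) (b 1) := by
  let Q : L.Formula (Fin 4) → Prop := fun π =>
    IsFactorable.{u, v, w} π ∧ HoldsOnMixedTuples.{u, v, w} E π
  -- `I` indexes the factorable formulas failing on some mixed tuple, `J` the remaining ones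
  let I : Type w := Shrink.{w} {π : L.Formula (Fin 4) //
    IsFactorable.{u, v, w} π ∧ ¬ HoldsOnMixedTuples.{u, v, w} E π}
  let J : Type w := Shrink.{w} {π : L.Formula (Fin 4) // Q π}
  let pI : I → L.Formula (Fin 4) := fun i => ((equivShrink _).symm i).1
  let pJ : J → L.Formula (Fin 4) := fun i => ((equivShrink _).symm i).1
  have hA : ∀ i : I, ∃ (A : FactoredAlgebra.{u, v, w} E) (a : Fin 4 → A.carrier),
      IsMixedTuple A a ∧ ¬ (pI i).Realize a := by
    intro i
    have := ((equivShrink _).symm i).2.2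
    unfold HoldsOnMixedTuples at this
    push Not at this
    exact this
  choose A a ha ha' using hA
  -- the counterexamples to the third condition, and the mixed tuples with a trivial first factor
  have hB : ∀ k : I ⊕ J, ∃ (B : FactoredAlgebra.{u, v, w} E) (b : Fin 4 → B.carrier),
      B.left.toSetoid (b 2) (b 3) ∧
      (∀ i, k = .inl i → (∀ π, Q π → π.Realize b) ∧ ¬ (pI i).Realize b) ∧
      ∀ j, k = .inr j → (pJ j).Realize b ∧ ¬ B.left.toSetoid (b 0) (b 1) := by
    rintro (i | j)
    · refine ⟨.ofTop (A i).carrier (A i).isModel, a i, trivial, ?_, by simp⟩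
      rintro i' h
      obtain rfl := Sum.inl_injective h
      exact ⟨fun π hπ => hπ.2 _ _ (ha i), ha' i⟩
    · obtain ⟨B, _, _, x, y, z, hB, hπ, hxy⟩ := h (pJ j) ((equivShrink _).symm j).2.1
        ((equivShrink _).symm j).2.2
      refine ⟨.ofBot B hB, ![x, y, z, z], rfl, by simp, ?_⟩
      rintro j' h
      obtain rfl := Sum.inr_injective h
      exact ⟨hπ, hxy⟩
  choose B b hb hbI hbJ using hB
  let FJ : Filter J := realizationFilter Q
    ⟨isFactorable_top, fun _ _ _ => Formula.realize_top.2 trivial⟩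
    (fun h h' => ⟨h.1.inf h'.1, fun A a ha => Formula.realize_inf.2 ⟨h.2 A a ha, h'.2 A a ha⟩⟩)
    fun j => b (.inr j)
  let F : Filter (I ⊕ J) := Filter.map .inl ⊤ ⊔ Filter.map .inr FJ
  have hF : ∀ p : I ⊕ J → Prop, (∀ᶠ k in F, p k) ↔
      (∀ i, p (.inl i)) ∧ ∃ π, Q π ∧ ∀ j, π.Realize (b (.inr j)) → p (.inr j) := by
    intro p
    rw [eventually_sup, eventually_map, eventually_map, eventually_top]
    rfl
  refine ⟨.reducedProduct ⊤ A, .reducedProduct F B, fun k => toReduced L _ fun i => a i k,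
    fun k => toReduced L _ fun i => b i k, ?_, ?_, ?_, ?_⟩
  · -- both sides say that `φ` holds on all mixed tuples
    intro φ hφ
    have hl : (φ.Realize fun k => toReduced L ⊤ fun i => a i k) ↔ Q φ := by
      refine (hφ I ⊤ _ _).trans (eventually_top.trans ⟨fun h => ⟨hφ, ?_⟩, fun h i => h.2 _ _ (ha i)⟩)
      by_contra hcon
      refine ha' (equivShrink _ ⟨φ, hφ, hcon⟩) ?_
      simpa [pI] using h (equivShrink _ ⟨φ, hφ, hcon⟩)
    have hr : (φ.Realize fun k => toReduced L F fun i => b i k) ↔ Q φ := by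
      refine (hφ (I ⊕ J) F _ _).trans ((hF _).trans ⟨fun h => ⟨hφ, ?_⟩, fun h =>
        ⟨fun i => (hbI _ i rfl).1 φ h, φ, h, fun _ h => h⟩⟩)
      by_contra hcon
      refine (hbI _ (equivShrink _ ⟨φ, hφ, hcon⟩) rfl).2 ?_
      simpa [pI] using h.1 (equivShrink _ ⟨φ, hφ, hcon⟩)
    exact hl.trans hr.symm
  · exact ⟨FactoredAlgebra.reducedProduct_left_iff.2 (.of_forall fun i => (ha i).1),
      FactoredAlgebra.reducedProduct_right_iff.2 (.of_forall fun i => (ha i).2.1),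
      FactoredAlgebra.reducedProduct_right_iff.2 (.of_forall fun i => (ha i).2.2)⟩
  · exact FactoredAlgebra.reducedProduct_left_iff.2 (.of_forall hb)
  · intro hcon
    obtain ⟨π, hπ, hπ'⟩ := ((hF _).1 (FactoredAlgebra.reducedProduct_left_iff.1 hcon)).2
    have hj := hbJ _ (equivShrink _ ⟨π, hπ⟩) rfl
    exact hj.2 (hπ' _ (by simpa [pJ] using hj.1))

theorem HasBFC.exists_formula [Small.{w} (L.Formula (Fin 4))] (hE : HasBFC.{u, v, w} E) :
    ∃ π : L.Formula (Fin 4), IsFactorable.{u, v, w} π ∧ SatisfiesStar.{u, v, w} E π := by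
  by_contra! hcon
  obtain ⟨A, B, a, b, hab, ha, hb, hb'⟩ := exists_factorablyEquiv_of_forall_not (E := E)
    fun π hπ hmix => by
      by_contra! h
      refine hcon π hπ fun A _ _ hA => ⟨fun x y => ?_, fun x z w => ?_, fun x y z hxyz => ?_⟩
      · exact hmix (.ofTop A hA) ![x, y, x, y] ⟨trivial, rfl, rfl⟩
      · exact hmix (.ofBot A hA) ![x, x, z, w] ⟨rfl, trivial, trivial⟩
      · exact h A _ inferInstance x y z hA hxyz
  exact hb' (hE.left_rel_of_factorablyEquiv hab ha hb)

end Formula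

end UniversalAlgebra

theorem theorem1 (L : FirstOrder.Language.{u, v}) [L.IsAlgebraic]
    (E : Set (UniversalAlgebra.Identity L)) :
    (∃ π : L.Formula (Fin 4),
      UniversalAlgebra.PreservedByFactors.{u, v, max u w} E π ∧
      UniversalAlgebra.PreservedByProducts.{u, v, max u w} E π ∧
      UniversalAlgebra.SatisfiesStar.{u, v, max u w} E π) ↔
    UniversalAlgebra.HasBFC.{u, v, max u w} E := by
  refine ⟨fun ⟨π, hF, hP, hS⟩ => UniversalAlgebra.hasBFC_of_satisfiesStar hF hP hS, fun hE => ?_⟩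
  have := UniversalAlgebra.small_formula.{u, v, w} (L := L)
  obtain ⟨π, hπ, hS⟩ := hE.exists_formula
  exact ⟨π, hπ.preservedByFactors, hπ.preservedByProducts, hS⟩
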